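/- Let $(E,\mathcal E,\mu)$ be a probability space and let $k:E\times E\to\mathbb R$ be a measurable kernel (symmetric and positive semidefinite) whose reproducing kernel Hilbert space $\mathcal H$ of functions on $E$ is separable. Put $\kappa(x)=\sqrt{k(x,x)}$ and assume $\|\kappa\|_{2,\mu}=(\int_E\kappa^2\,d\mu)^{1/2}<\infty$. Then the elements of $\mathcal H$ are measurable functions, and the operator $J:\mathcal H\to L^2_\mu$ that maps $h\in\mathcal H$ to its $\mu$-equivalence class is well-defined and bounded; let $J^*$ denote its adjoint. For an operator $T$ on $\mathcal H$ let $\|T\|$ be the operator norm and $\|T\|_2=(\sum_i\|T\phi_i\|_{\mathcal H}^2)^{1/2}$, for any orthonormal basis $(\phi_i)$ of $\mathcal H$, the Hilbert--Schmidt norm. Let $\|\kappa\|_{\infty,\mu}=\inf\{c\ge 0\mid \kappa\le c\ \mu\text{-a.s.}\}\in[0,\infty]$. Let $\lambda\ge 0$ be such that $J^*J+\lambda:\mathcal H\to\mathcal H$ is invertible, and let $\delta\in[0,1)$. Let $n\ge 1$ and let $\bm X=(X^{(1)},\dots,X^{(n)})$ be i.i.d. $E$-valued random variables with law $\mu$ on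 a probability space with probability measure $\bm\mu$. Let $J_{\bm X}:\mathcal H\to L^2_{\mu_{\bm X}}$ be the operator defined as $J$ with the empirical measure $\mu_{\bm X}=\frac1n\sum_{i=1}^n\delta_{X^{(i)}}$ in place of $\mu$. Define the sampling event $$\mathcal S=\Bigl\{\|J_{\bm X}^*J_{\bm X}-J^*J\|_2\le \frac{\delta}{\|(J^*J+\lambda)^{-1}\|}\Bigr\}.$$ Then $\mathcal S$ is measurable, and the following hold. 1. On $\mathcal S$, the operator $J_{\bm X}^*J_{\bm X}+\lambda:\mathcal H\to\mathcal H$ is invertible and $$\|(J_{\bm X}^*J_{\bm X}+\lambda)^{-1}\|\le\frac{\|(J^*J+\lambda)^{-1}\|}{1-\delta}.$$ 2. The probability of $\mathcal S$ is bounded below by $$\bm\mu[\mathcal S]\ge 1-2\exp\Bigl(-\frac{\delta^2 n}{4\|\kappa\|_{\infty,\mu}^4\|(J^*J+\lambda)^{-1}\|^2}\Bigr).$$ Here the fraction in the exponent is read in $[0,\infty]$: it is $0$ if $\|\kappa\|_{\infty,\mu}=\infty$, it is $\infty$ (and the exponential is $0$) if its denominator is $0$ and $\delta>0$, and it is $0$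 if its denominator is $0$ and $\delta=0$. -/

import Mathlib

open MeasureTheory ProbabilityTheory
open scoped ENNReal InnerProductSpace

namespace KernelSampling

noncomputable section

set_option linter.unusedSectionVars false

section HilbertSchmidt

variable {H H' : Type*} [NormedAddCommGroup H] [InnerProductSpace ℝ H] [CompleteSpace H]
  [NormedAddCommGroup H'] [InnerProductSpace ℝ H'] [CompleteSpace H']

/-- The Hilbert–Schmidt norm `‖T‖₂ = (∑ᵢ ‖T φᵢ‖²)^(1/2)`, computed in a chosen orthonormal basis
`(φᵢ)` of `H`, with value `∞` if `T` is not Hilbert–Schmidt. It does not depend on the chosen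
basis, see `hsNorm_eq`. -/
def hsNorm (T : H →L[ℝ] H') : ℝ≥0∞ :=
  (∑' φ : (exists_hilbertBasis ℝ H).choose, ‖T (φ : H)‖ₑ ^ 2) ^ (1 / 2 : ℝ)

/-- Parseval's identity with values in `[0, ∞]`. -/
theorem parseval {ι : Type*} (b : HilbertBasis ι ℝ H) (v : H) :
    ∑' i, ‖⟪v, b i⟫_ℝ‖ₑ ^ 2 = ‖v‖ₑ ^ 2 := by
  have h := b.hasSum_inner_mul_inner v v
  have h1 : ∀ i, ‖⟪v, b i⟫_ℝ‖ₑ ^ 2 = ENNReal.ofReal (⟪v, b i⟫_ℝ * ⟪b i, v⟫_ℝ) := by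
    intro i
    rw [← ofReal_norm, ← ENNReal.ofReal_pow (norm_nonneg _), real_inner_comm v (b i),
      Real.norm_eq_abs, sq_abs, sq]
  simp_rw [h1]
  rw [← ENNReal.ofReal_tsum_of_nonneg (fun i => by
    rw [real_inner_comm v (b i)]; exact mul_self_nonneg _) h.summable, h.tsum_eq,
    real_inner_self_eq_norm_sq, ENNReal.ofReal_pow (norm_nonneg _), ofReal_norm]

theorem tsum_adjoint {ι ι' : Type*} (b : HilbertBasis ι ℝ H) (c : HilbertBasis ι' ℝ H')
    (T : H →L[ℝ] H') :
    ∑' i, ‖T (b i)‖ₑ ^ 2 = ∑' j, ‖T.adjoint (c j)‖ₑ ^ 2 := by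
  simp_rw [← parseval c (T _), ← parseval b (T.adjoint _)]
  rw [ENNReal.tsum_comm]
  refine tsum_congr fun j => tsum_congr fun i => ?_
  rw [ContinuousLinearMap.adjoint_inner_left, real_inner_comm]

/-- The Hilbert–Schmidt norm can be computed in any orthonormal basis. -/
theorem hsNorm_eq {ι : Type*} (b : HilbertBasis ι ℝ H) (T : H →L[ℝ] H') :
    hsNorm T = (∑' i, ‖T (b i)‖ₑ ^ 2) ^ (1 / 2 : ℝ) := by
  obtain ⟨c, hc⟩ := (exists_hilbertBasis ℝ H).choose_spec
  obtain ⟨w, d, -⟩ := exists_hilbertBasis ℝ H'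
  have h : ∑' φ : (exists_hilbertBasis ℝ H).choose, ‖T (φ : H)‖ₑ ^ 2
      = ∑' i, ‖T (b i)‖ₑ ^ 2 := by
    rw [tsum_adjoint b d, ← tsum_adjoint c d]
    simp [hc]
  rw [hsNorm, h]

end HilbertSchmidt

section Embedding

variable {E : Type*} (H : Type*) [NormedAddCommGroup H] [InnerProductSpace ℝ H]
  [CompleteSpace H] [RKHS ℝ H E ℝ]

/-- The reproducing kernel `k : E × E → ℝ` of a real RKHS `H` of functions on `E`. -/
def kernel (x y : E) : ℝ := RKHS.kernel H x y 1

/-- `κ(x) = √k(x, x)`. -/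
def kappa (x : E) : ℝ := √(kernel H x x)

variable {H}

theorem kappa_eq (x : E) : kappa H x = ‖RKHS.kerFun H x (1 : ℝ)‖ := by
  have h : kernel H x x = ‖RKHS.kerFun H x (1 : ℝ)‖ ^ 2 := by
    rw [← real_inner_self_eq_norm_sq, RKHS.kerFun_inner, RKHS.kerFun_apply]
    simp [kernel]
  rw [kappa, h, Real.sqrt_sq (norm_nonneg _)]

theorem norm_apply_le (h : H) (x : E) : ‖h x‖ ≤ kappa H x * ‖h‖ := by
  have h1 : h x = ⟪RKHS.kerFun H x (1 : ℝ), h⟫_ℝ := by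
    rw [RKHS.kerFun_inner]; simp
  rw [h1, kappa_eq]
  exact norm_inner_le_norm _ _

variable [MeasurableSpace E]

theorem measurable_kappa (hk : Measurable fun p : E × E => kernel H p.1 p.2) :
    Measurable (kappa H) :=
  (hk.comp (measurable_id.prodMk measurable_id)).sqrt

theorem measurable_kerFun (hk : Measurable fun p : E × E => kernel H p.1 p.2) (x : E) :
    Measurable (RKHS.kerFun H x (1 : ℝ) : E → ℝ) := by
  have h1 : Measurable fun y : E => kernel H y x :=
    Measurable.comp (f := fun y : E => (y, x)) hk (measurable_id.prodMk measurable_const)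
  have h2 : (RKHS.kerFun H x (1 : ℝ) : E → ℝ) = fun y => kernel H y x := by
    funext y
    exact RKHS.kerFun_apply (H := H) x (1 : ℝ) y
  rw [h2]
  exact h1

/-- If the kernel is measurable, then `H` consists of measurable functions. -/
theorem measurable_coe (hk : Measurable fun p : E × E => kernel H p.1 p.2) (h : H) :
    Measurable (h : E → ℝ) := by
  let M : Submodule ℝ H :=
    { carrier := {h | Measurable (h : E → ℝ)}
      add_mem' := fun {a b} ha hb => by
        change Measurable _
        rw [RKHS.coe_add]; exact Measurable.add ha hb
      zero_mem' := by
        change Measurable _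
        rw [RKHS.coe_zero]; exact measurable_const
      smul_mem' := fun c a ha => by
        change Measurable _
        rw [RKHS.coe_smul]; exact Measurable.const_smul ha c }
  have hcl : IsClosed (M : Set H) := by
    refine IsSeqClosed.isClosed fun u a hu ha => ?_
    refine measurable_of_tendsto_metrizable (f := fun n => (u n : E → ℝ)) hu ?_
    rw [tendsto_pi_nhds]
    exact fun x => ((RKHS.continuous_eval x).tendsto a).comp ha
  have hsub : Submodule.span ℝ {RKHS.kerFun H x v | (x : E) (v : ℝ)} ≤ M := by
    rw [Submodule.span_le]
    rintro _ ⟨x, v, rfl⟩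
    have hv : RKHS.kerFun H x v = v • RKHS.kerFun H x (1 : ℝ) := by
      rw [← map_smul]; simp
    rw [hv]
    exact M.smul_mem v (measurable_kerFun hk x)
  have htop : (⊤ : Submodule ℝ H) ≤ M := by
    rw [← RKHS.kerFun_dense (𝕜 := ℝ) (H := H)]
    exact Submodule.topologicalClosure_minimal _ hsub hcl
  exact htop (Submodule.mem_top (x := h))

theorem memLp_coe {μ : Measure E} (hk : Measurable fun p : E × E => kernel H p.1 p.2)
    (hκ : MemLp (kappa H) 2 μ) (h : H) : MemLp (h : E → ℝ) 2 μ := by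
  refine MemLp.of_le_mul (c := ‖h‖) hκ (measurable_coe hk h).aestronglyMeasurable ?_
  refine Filter.Eventually.of_forall fun x => ?_
  refine (norm_apply_le h x).trans ?_
  rw [mul_comm]
  gcongr
  exact le_abs_self _

/-- The bounded operator `J : H → L²(μ)` that maps `h ∈ H` to its `μ`-equivalence class, for a
measurable kernel with `‖κ‖_{2,μ} < ∞`. -/
def embedding (μ : Measure E) (hk : Measurable fun p : E × E => kernel H p.1 p.2)
    (hκ : MemLp (kappa H) 2 μ) : H →L[ℝ] Lp ℝ 2 μ :=
  LinearMap.mkContinuous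
    { toFun := fun h => (memLp_coe hk hκ h).toLp (h : E → ℝ)
      map_add' := fun a b => by
        rw [← MemLp.toLp_add]
        exact MemLp.toLp_congr _ _ (by rw [RKHS.coe_add])
      map_smul' := fun c a => by
        rw [RingHom.id_apply, ← MemLp.toLp_const_smul]
        exact MemLp.toLp_congr _ _ (by rw [RKHS.coe_smul]) }
    (eLpNorm (kappa H) 2 μ).toReal
    (fun h => by
      change ‖(memLp_coe hk hκ h).toLp (h : E → ℝ)‖ ≤ _
      rw [Lp.norm_toLp]
      have hle : eLpNorm (h : E → ℝ) 2 μ ≤ ENNReal.ofReal ‖h‖ * eLpNorm (kappa H) 2 μ := by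
        refine eLpNorm_le_mul_eLpNorm_of_ae_le_mul (Filter.Eventually.of_forall fun x => ?_) 2
        refine (norm_apply_le h x).trans ?_
        rw [mul_comm]
        gcongr
        exact le_abs_self _
      refine (ENNReal.toReal_mono (ENNReal.mul_ne_top ENNReal.ofReal_ne_top hκ.2.ne) hle).trans ?_
      rw [ENNReal.toReal_mul, ENNReal.toReal_ofReal (norm_nonneg _), mul_comm])

/-- `J h` is the `μ`-equivalence class of `h`. -/
theorem embedding_coe (μ : Measure E) (hk : Measurable fun p : E × E => kernel H p.1 p.2)
    (hκ : MemLp (kappa H) 2 μ) (h : H) : embedding μ hk hκ h =ᵐ[μ] h :=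
  (memLp_coe hk hκ h).coeFn_toLp

/-- The empirical measure `(1/n) ∑ᵢ δ_{xᵢ}` of a sample `x = (x₁, …, xₙ)`. -/
def empiricalMeasure {n : ℕ} (x : Fin n → E) : Measure E :=
  (n : ℝ≥0∞)⁻¹ • ∑ i, Measure.dirac (x i)

theorem memLp_kappa_empirical (hk : Measurable fun p : E × E => kernel H p.1 p.2) {n : ℕ}
    (x : Fin n → E) : MemLp (kappa H) 2 (empiricalMeasure x) := by
  rcases Nat.eq_zero_or_pos n with rfl | hn
  · simp [empiricalMeasure]
  have hfin : MemLp (kappa H) 2 (∑ i, Measure.dirac (x i)) := by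
    refine MemLp.of_bound (measurable_kappa hk).aestronglyMeasurable (∑ i, kappa H (x i)) ?_
    have hs : MeasurableSet {a | ‖kappa H a‖ ≤ ∑ i, kappa H (x i)} :=
      measurableSet_le (measurable_kappa hk).norm measurable_const
    rw [ae_iff, ← Set.compl_ofPred, Measure.finsetSum_apply]
    refine Finset.sum_eq_zero fun i _ => ?_
    rw [Measure.dirac_apply' _ hs.compl, Set.indicator_of_notMem]
    simp only [Set.mem_compl_iff, Set.mem_ofPred_eq, not_not]
    rw [Real.norm_of_nonneg (by exact Real.sqrt_nonneg _)]
    exact Finset.single_le_sum (f := fun i => kappa H (x i))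
      (fun j _ => Real.sqrt_nonneg _) (Finset.mem_univ i)
  exact hfin.smul_measure (by simp [hn.ne'])

/-- The operator `J* J : H → H` for the measure `μ`. -/
def JstarJ (μ : Measure E) (hk : Measurable fun p : E × E => kernel H p.1 p.2)
    (hκ : MemLp (kappa H) 2 μ) : H →L[ℝ] H :=
  (embedding μ hk hκ).adjoint ∘L embedding μ hk hκ

/-- The sample operator `J_x* J_x : H → H`, where `J_x : H → L²(μ_x)` is the embedding for the
empirical measure `μ_x` of the sample `x`. -/
def sampleJstarJ (hk : Measurable fun p : E × E => kernel H p.1 p.2) {n : ℕ} (x : Fin n → E) :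
    H →L[ℝ] H :=
  JstarJ (empiricalMeasure x) hk (memLp_kappa_empirical hk x)

/-- The sampling event
`S = {‖J_X* J_X - J* J‖₂ ≤ δ / ‖(J* J + lam)⁻¹‖}`. -/
def samplingEvent (μ : Measure E) (hk : Measurable fun p : E × E => kernel H p.1 p.2)
    (hκ : MemLp (kappa H) 2 μ) (lam δ : ℝ) {Ω : Type*} {n : ℕ} (X : Fin n → Ω → E) : Set Ω :=
  {ω | hsNorm (sampleJstarJ hk (fun i => X i ω) - JstarJ μ hk hκ) ≤
    ENNReal.ofReal (δ / ‖Ring.inverse (JstarJ μ hk hκ + lam • (1 : H →L[ℝ] H))‖)}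

end Embedding

end

end KernelSampling

/-! Invertibility on the sampling event is a Neumann series argument: the operator norm is at most
the Hilbert–Schmidt norm (`norm_le_hsNorm`), so the perturbation is small relative to the inverse
(`isUnit_and_norm_inverse_le`).

For the probability, `J_X* J_X - J* J` is an average of centred i.i.d. rank one operators, to which
a dimension-free Hoeffding inequality applies (`measureReal_norm_sum_gt_le`). To avoid integrating
operators, everything is compressed to a finite set `F` of basis vectors, where the matrices `(bᵢ(x)
bⱼ(x))` are Euclidean vectors of norm at most `κ(x)²`. Their pairwise inner products are squares, so
centring costs only a factor `√2`, and Hoeffding with `r = n t` and bound `√2 M²` gives the exponent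
`-t² n / (4 M⁴)`. This is independent of `F`, and the exceedance events increase with `F` to the
complement of the sampling event, so the bound passes to the limit without loss. -/

namespace KernelSampling

/-! ### Hoeffding's inequality in a Hilbert space. -/

section Hoeffding

/-- `cosh ∘ √` is convex and increasing. -/
theorem cosh_le_convex_combination {p q a c w : ℝ} (hp : 0 ≤ p) (hq : 0 ≤ q) (hpq : p + q = 1)
    (h : w ^ 2 ≤ p * a ^ 2 + q * c ^ 2) :
    Real.cosh w ≤ p * Real.cosh a + q * Real.cosh c := by
  -- Both sides are series in the squares with coefficients `1 / (2n)!`; they compare term by term,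
  -- by convexity of `s ↦ s ^ n` on `[0, ∞)`.
  refine hasSum_le (fun n => ?_) (Real.hasSum_cosh w)
    (((Real.hasSum_cosh a).mul_left p).add ((Real.hasSum_cosh c).mul_left q))
  have hconv := (convexOn_pow (𝕜 := ℝ) n).2 (x := a ^ 2) (y := c ^ 2) (Set.mem_Ici.2 (sq_nonneg a))
    (Set.mem_Ici.2 (sq_nonneg c)) hp hq hpq
  simp only [smul_eq_mul] at hconv
  rw [← mul_div_assoc, ← mul_div_assoc, ← add_div, pow_mul, pow_mul, pow_mul]
  gcongr
  exact (pow_le_pow_left₀ (sq_nonneg w) h n).trans hconv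

theorem ae_norm_sum_le {V Ω ι : Type*} [NormedAddCommGroup V] [MeasurableSpace Ω]
    {P : Measure Ω} {Y : ι → Ω → V} {b : ℝ} (hb : ∀ i, ∀ᵐ ω ∂P, ‖Y i ω‖ ≤ b)
    (s : Finset ι) : ∀ᵐ ω ∂P, ‖∑ i ∈ s, Y i ω‖ ≤ s.card * b := by
  have h := (Filter.eventually_all_finset s).2 fun i _ => hb i
  filter_upwards [h] with ω hω
  refine (norm_sum_le_of_le s hω).trans_eq ?_
  simp

variable {V : Type*} [NormedAddCommGroup V] [InnerProductSpace ℝ V]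

/-- With `⟪x, d⟫ = ‖x‖ v`, the bound `‖x + d‖² ≤ ‖x‖² + 2 ‖x‖ v + b²` holds, and its right side is
the convex combination of `(‖x‖ ± b)²` with weights `(b ± v) / (2b)`. Applying `cosh` leaves a
remainder linear in `d`, which averages to zero for an independent centred increment. -/
theorem cosh_norm_add_le {b : ℝ} (hb : 0 < b) (x d : V) (hd : ‖d‖ ≤ b) :
    Real.cosh ‖x + d‖ ≤ Real.cosh ‖x‖ * Real.cosh b +
      ⟪(Real.sinh ‖x‖ * Real.sinh b / (‖x‖ * b)) • x, d⟫_ℝ := by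
  rcases eq_or_ne x 0 with rfl | hx
  · simpa using abs_le_abs_of_nonneg (norm_nonneg d) hd
  have hu : 0 < ‖x‖ := norm_pos_iff.2 hx
  set u := ‖x‖ with hu_def
  obtain ⟨v, hv⟩ : ∃ v, ⟪x, d⟫_ℝ = u * v := ⟨⟪x, d⟫_ℝ / u, by field_simp⟩
  have hvb : |v| ≤ b := by
    have h1 := abs_real_inner_le_norm x d
    rw [hv, abs_mul, abs_of_pos hu] at h1
    exact (le_of_mul_le_mul_left h1 hu).trans hd
  obtain ⟨hv1, hv2⟩ := abs_le.1 hvb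
  have key := cosh_le_convex_combination (p := (b + v) / (2 * b)) (q := (b - v) / (2 * b))
    (a := u + b) (c := u - b) (w := ‖x + d‖) (div_nonneg (by linarith) (by linarith))
    (div_nonneg (by linarith) (by linarith)) (by field_simp; ring) (by
      rw [norm_add_sq_real, hv, ← hu_def]
      have : (b + v) / (2 * b) * (u + b) ^ 2 + (b - v) / (2 * b) * (u - b) ^ 2
          = u ^ 2 + 2 * (u * v) + b ^ 2 := by field_simp; ring
      rw [this]
      gcongr)
  refine key.trans_eq ?_
  rw [real_inner_smul_left, hv, Real.cosh_add, Real.cosh_sub]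
  field_simp
  ring

variable [CompleteSpace V] [MeasurableSpace V] [BorelSpace V] [SecondCountableTopology V]
  {Ω : Type*} [MeasurableSpace Ω] {P : Measure Ω} [IsProbabilityMeasure P]

theorem integral_cosh_norm_add_le {S Y : Ω → V} (hSm : Measurable S) (hYm : Measurable Y)
    (hind : IndepFun S Y P) {b c : ℝ} (hb0 : 0 < b) (hS : ∀ᵐ ω ∂P, ‖S ω‖ ≤ c)
    (hY : ∀ᵐ ω ∂P, ‖Y ω‖ ≤ b) (hmean : ∫ ω, Y ω ∂P = 0) :
    ∫ ω, Real.cosh ‖S ω + Y ω‖ ∂P ≤ (∫ ω, Real.cosh ‖S ω‖ ∂P) * Real.cosh b := by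
  let G : V → V := fun x => (Real.sinh ‖x‖ * Real.sinh b / (‖x‖ * b)) • x
  have hGm : Measurable G := by
    have h1 : Measurable fun x : V => Real.sinh ‖x‖ * Real.sinh b / (‖x‖ * b) :=
      ((Real.measurable_sinh.comp measurable_norm).mul_const _).div (measurable_norm.mul_const _)
    exact h1.smul measurable_id
  have hG : ∀ x, ‖x‖ ≤ c → ‖G x‖ ≤ Real.sinh c * Real.sinh b / b := by
    intro x hx
    have hc : 0 ≤ c := (norm_nonneg x).trans hx
    have hsc : 0 ≤ Real.sinh c := Real.sinh_nonneg_iff.2 hc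
    have hsb : 0 ≤ Real.sinh b := Real.sinh_nonneg_iff.2 hb0.le
    rcases eq_or_ne x 0 with rfl | hx0
    · simp only [G, smul_zero, norm_zero]
      positivity
    have hu : 0 < ‖x‖ := norm_pos_iff.2 hx0
    have hsu : 0 ≤ Real.sinh ‖x‖ := Real.sinh_nonneg_iff.2 hu.le
    have h1 : ‖G x‖ = Real.sinh ‖x‖ * Real.sinh b / b := by
      rw [norm_smul, Real.norm_of_nonneg (by positivity)]
      field_simp
    rw [h1]
    gcongr
    exact Real.sinh_le_sinh.2 hx
  have hYi : Integrable Y P := Integrable.of_bound hYm.aestronglyMeasurable b hY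
  have hGi : Integrable (G ∘ S) P := by
    refine Integrable.of_bound (hGm.comp hSm).aestronglyMeasurable
      (Real.sinh c * Real.sinh b / b) ?_
    filter_upwards [hS] with ω hω using hG _ hω
  have hindG : IndepFun (G ∘ S) Y P := hind.comp hGm measurable_id
  -- Independence factors the expectation into the inner product of the two means.
  have hzero : ∫ ω, ⟪G (S ω), Y ω⟫_ℝ ∂P = 0 := by
    have h := hindG.integral_bilin hGi hYi (innerSL ℝ)
    rw [hmean, map_zero] at h
    exact h
  have hinner : Integrable (fun ω => ⟪G (S ω), Y ω⟫_ℝ) P :=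
    hindG.integrable_bilin hGi hYi (innerSL ℝ)
  have hcosh : ∀ {Z : Ω → V} {r : ℝ}, Measurable Z → (∀ᵐ ω ∂P, ‖Z ω‖ ≤ r) →
      Integrable (fun ω => Real.cosh ‖Z ω‖) P := by
    intro Z r hZ hr
    refine Integrable.of_bound
      (Real.measurable_cosh.comp hZ.norm).aestronglyMeasurable (Real.cosh r) ?_
    filter_upwards [hr] with ω hω
    rw [Real.norm_of_nonneg (Real.cosh_pos _).le]
    exact Real.cosh_le_cosh.2 (abs_le_abs_of_nonneg (norm_nonneg _) hω)
  have hSY : ∀ᵐ ω ∂P, ‖S ω + Y ω‖ ≤ c + b := by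
    filter_upwards [hS, hY] with ω h1 h2 using norm_add_le_of_le h1 h2
  calc ∫ ω, Real.cosh ‖S ω + Y ω‖ ∂P
      ≤ ∫ ω, (Real.cosh ‖S ω‖ * Real.cosh b + ⟪G (S ω), Y ω⟫_ℝ) ∂P := by
        refine integral_mono_ae (hcosh (hSm.add hYm) hSY) (((hcosh hSm hS).mul_const _).add hinner) ?_
        filter_upwards [hY] with ω hω using cosh_norm_add_le hb0 _ _ hω
    _ = _ := by
        rw [integral_add ((hcosh hSm hS).mul_const _) hinner, hzero, add_zero, integral_mul_const]

theorem integral_cosh_norm_sum_le {ι : Type*} {Y : ι → Ω → V} (hYm : ∀ i, Measurable (Y i))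
    (hind : iIndepFun Y P) {b : ℝ} (hb0 : 0 < b) (hY : ∀ i, ∀ᵐ ω ∂P, ‖Y i ω‖ ≤ b)
    (hmean : ∀ i, ∫ ω, Y i ω ∂P = 0) (s : Finset ι) :
    ∫ ω, Real.cosh ‖∑ i ∈ s, Y i ω‖ ∂P ≤ Real.cosh b ^ s.card := by
  classical
  induction s using Finset.induction_on with
  | empty => simp
  | insert i s hi ih =>
    have h1 : IndepFun (fun ω => ∑ j ∈ s, Y j ω) (Y i) P := by
      convert hind.indepFun_finsetSum_of_notMem hYm hi using 1
      ext ω; simp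
    have h2 := integral_cosh_norm_add_le (Finset.measurable_fun_sum s fun j _ => hYm j) (hYm i) h1
      hb0 (ae_norm_sum_le hY s) (hY i) (hmean i)
    simp_rw [Finset.sum_insert hi, Finset.card_insert_of_notMem hi, pow_succ, add_comm (Y i _)]
    exact h2.trans (mul_le_mul_of_nonneg_right ih (Real.cosh_pos b).le)

/-- Hoeffding's inequality for sums of independent centered bounded random variables in a Hilbert
space (Pinelis). -/
theorem measureReal_norm_sum_gt_le {ι : Type*} [Fintype ι] [Nonempty ι] {Y : ι → Ω → V}
    (hYm : ∀ i, Measurable (Y i)) (hind : iIndepFun Y P) {b : ℝ} (hb0 : 0 < b)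
    (hY : ∀ i, ∀ᵐ ω ∂P, ‖Y i ω‖ ≤ b) (hmean : ∀ i, ∫ ω, Y i ω ∂P = 0) {r : ℝ} (hr : 0 ≤ r) :
    P.real {ω | r < ‖∑ i, Y i ω‖} ≤
      2 * Real.exp (-(r ^ 2 / (2 * Fintype.card ι * b ^ 2))) := by
  rcases hr.eq_or_lt with rfl | hr
  · have := measureReal_le_one (μ := P) (s := {ω | 0 < ‖∑ i, Y i ω‖})
    simp only [ne_eq, OfNat.ofNat_ne_zero, not_false_eq_true, zero_pow, zero_div, neg_zero,
      Real.exp_zero]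
    linarith
  set N : ℝ := (Fintype.card ι : ℝ) with hN_def
  have hN : 0 < N := by simp [hN_def, Fintype.card_pos]
  -- The minimiser of the Chernoff exponent `N (t b)² / 2 - t r`.
  set t : ℝ := r / (N * b ^ 2) with ht_def
  have ht : 0 < t := by positivity
  have h1 := integral_cosh_norm_sum_le (Y := fun i ω => t • Y i ω) (P := P)
    (fun i => (hYm i).const_smul t)
    (hind.comp (fun _ v => t • v) fun _ => measurable_const_smul t) (mul_pos ht hb0)
    (fun i => by
      filter_upwards [hY i] with ω hω
      rw [norm_smul, Real.norm_of_nonneg ht.le]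
      gcongr) (fun i => by rw [integral_smul, hmean, smul_zero]) Finset.univ
  have hs : ∀ ω, ‖∑ i, t • Y i ω‖ = t * ‖∑ i, Y i ω‖ := fun ω => by
    rw [← Finset.smul_sum, norm_smul, Real.norm_of_nonneg ht.le]
  simp_rw [hs, Finset.card_univ] at h1
  have hint : Integrable (fun ω => Real.cosh (t * ‖∑ i, Y i ω‖)) P := by
    refine Integrable.of_bound (Real.measurable_cosh.comp
      ((Finset.measurable_fun_sum _ fun j _ => hYm j).norm.const_mul t)).aestronglyMeasurable
      (Real.cosh (t * ((Finset.univ : Finset ι).card * b))) ?_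
    filter_upwards [ae_norm_sum_le hY Finset.univ] with ω hω
    rw [Real.norm_of_nonneg (Real.cosh_pos _).le]
    refine Real.cosh_le_cosh.2 (abs_le_abs_of_nonneg (by positivity) ?_)
    gcongr
  have hmarkov := mul_meas_ge_le_integral_of_nonneg (μ := P)
    (Filter.Eventually.of_forall fun ω => (Real.cosh_pos (t * ‖∑ i, Y i ω‖)).le) hint
    (Real.cosh (t * r))
  have hsub : P.real {ω | r < ‖∑ i, Y i ω‖} ≤
      P.real {ω | Real.cosh (t * r) ≤ Real.cosh (t * ‖∑ i, Y i ω‖)} := by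
    refine measureReal_mono fun ω hω => ?_
    refine Real.cosh_le_cosh.2 (abs_le_abs_of_nonneg (by positivity) ?_)
    have : r < ‖∑ i, Y i ω‖ := hω
    gcongr
  -- The half lost here is the factor `2` in the final bound.
  have hcosh : Real.exp (t * r) / 2 ≤ Real.cosh (t * r) := by
    rw [Real.cosh_eq]
    have := Real.exp_pos (-(t * r))
    linarith
  have hup : Real.cosh (t * b) ^ Fintype.card ι ≤ Real.exp (N * (t * b) ^ 2 / 2) := by
    calc Real.cosh (t * b) ^ Fintype.card ι
        ≤ Real.exp ((t * b) ^ 2 / 2) ^ Fintype.card ι :=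
          pow_le_pow_left₀ (Real.cosh_pos _).le (Real.cosh_le_exp_half_sq _) _
      _ = _ := by rw [← Real.exp_nat_mul]; congr 1; ring
  have hfin : Real.exp (t * r) / 2 * P.real {ω | r < ‖∑ i, Y i ω‖} ≤
      Real.exp (N * (t * b) ^ 2 / 2) :=
    calc _ ≤ Real.cosh (t * r) *
          P.real {ω | Real.cosh (t * r) ≤ Real.cosh (t * ‖∑ i, Y i ω‖)} := by gcongr
      _ ≤ _ := hmarkov.trans (h1.trans hup)
  have hexp : -(r ^ 2 / (2 * N * b ^ 2)) = N * (t * b) ^ 2 / 2 - t * r := by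
    rw [ht_def]; field_simp; ring
  rw [hexp, Real.exp_sub, ← mul_div_assoc, le_div_iff₀ (Real.exp_pos _)]
  linarith

end Hoeffding

/-! ### Hilbert–Schmidt norms through matrix entries. -/

section HilbertSchmidtEntries

variable {H H' : Type*} [NormedAddCommGroup H] [InnerProductSpace ℝ H]
  [NormedAddCommGroup H'] [InnerProductSpace ℝ H'] [CompleteSpace H']

/-- Distinct basis vectors are at distance `√2`, so the balls of radius `1/2` around them are
disjoint. -/
theorem countable_of_hilbertBasis [TopologicalSpace.SeparableSpace H] {ι : Type*}
    (b : HilbertBasis ι ℝ H) : Countable ι := by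
  refine Pairwise.countable_of_isOpen_disjoint (s := fun i => Metric.ball (b i) (1 / 2))
    (fun i j hij => Metric.ball_disjoint_ball ?_) (fun i => Metric.isOpen_ball)
    fun i => Metric.nonempty_ball.2 (by norm_num)
  have h : ‖b i - b j‖ ^ 2 = 2 := by
    rw [norm_sub_sq_real, b.orthonormal.1, b.orthonormal.1, b.orthonormal.2 hij]
    norm_num
  rw [dist_eq_norm]
  nlinarith [norm_nonneg (b i - b j)]

variable [CompleteSpace H]

/-- A unit vector `v` extends to an orthonormal basis, and `‖T v‖²` is then one term of a sum that
does not depend on the basis. -/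
theorem norm_le_hsNorm (T : H →L[ℝ] H') : ‖T‖ₑ ≤ hsNorm T := by
  have hunit : ∀ v : H, ‖v‖ = 1 → ‖T v‖ₑ ≤ hsNorm T := by
    intro v hv
    have ho : Orthonormal ℝ ((↑) : ({v} : Set H) → H) :=
      ⟨fun i => by rw [Set.mem_singleton_iff.1 i.2, hv],
        fun i j hij => absurd (Subsingleton.elim i j) hij⟩
    obtain ⟨w, b, hw, hb⟩ := ho.exists_hilbertBasis_extension
    rw [hsNorm_eq b]
    have h1 := ENNReal.le_tsum (f := fun i => ‖T (b i)‖ₑ ^ 2) ⟨v, hw rfl⟩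
    simp only [hb] at h1 ⊢
    refine le_trans ?_ (ENNReal.rpow_le_rpow h1 (by norm_num))
    rw [← ENNReal.rpow_natCast, ← ENNReal.rpow_mul]
    norm_num
  by_cases htop : hsNorm T = ∞
  · rw [htop]; exact le_top
  rw [← ofReal_norm]
  refine ENNReal.ofReal_le_of_le_toReal
    (T.opNorm_le_of_unit_norm ENNReal.toReal_nonneg fun v hv => ?_)
  rw [← toReal_enorm]
  exact ENNReal.toReal_mono htop (hunit v hv)

theorem hsNorm_le_iff_tsum_inner {ι : Type*} (b : HilbertBasis ι ℝ H) (T : H →L[ℝ] H) (c : ℝ≥0∞) :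
    hsNorm T ≤ c ↔ ∑' p : ι × ι, ‖⟪T (b p.1), b p.2⟫_ℝ‖ₑ ^ 2 ≤ c ^ 2 := by
  rw [ENNReal.tsum_prod (f := fun i j => ‖⟪T (b i), b j⟫_ℝ‖ₑ ^ 2)]
  simp_rw [parseval b]
  rw [hsNorm_eq b, one_div, ENNReal.rpow_inv_le_iff (by norm_num)]
  simp

/-- Square blocks are cofinal among the finite sets of index pairs. This reduces the tail bound to
finite matrices. -/
theorem hsNorm_le_iff_forall_sum {ι : Type*} (b : HilbertBasis ι ℝ H) (T : H →L[ℝ] H) {t : ℝ}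
    (ht : 0 ≤ t) : hsNorm T ≤ ENNReal.ofReal t ↔
      ∀ F : Finset ι, ∑ p ∈ F ×ˢ F, ⟪T (b p.1), b p.2⟫_ℝ ^ 2 ≤ t ^ 2 := by
  classical
  have hsum : ∀ G : Finset (ι × ι), ∑ p ∈ G, ‖⟪T (b p.1), b p.2⟫_ℝ‖ₑ ^ 2 =
      ENNReal.ofReal (∑ p ∈ G, ⟪T (b p.1), b p.2⟫_ℝ ^ 2) := by
    intro G
    rw [ENNReal.ofReal_sum_of_nonneg fun _ _ => sq_nonneg _]
    refine Finset.sum_congr rfl fun p _ => ?_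
    rw [← ofReal_norm, ← ENNReal.ofReal_pow (norm_nonneg _), Real.norm_eq_abs, sq_abs]
  rw [hsNorm_le_iff_tsum_inner b, ← ENNReal.ofReal_pow ht]
  constructor
  · intro h F
    have := (ENNReal.sum_le_tsum (F ×ˢ F)).trans h
    rwa [hsum, ENNReal.ofReal_le_ofReal_iff (sq_nonneg t)] at this
  · intro h
    rw [ENNReal.tsum_eq_iSup_sum]
    refine iSup_le fun G => ?_
    rw [hsum]
    refine ENNReal.ofReal_le_ofReal (le_trans ?_ (h (G.image Prod.fst ∪ G.image Prod.snd)))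
    refine Finset.sum_le_sum_of_subset_of_nonneg (fun p hp => ?_) fun _ _ _ => sq_nonneg _
    simp only [Finset.mem_product, Finset.mem_union]
    exact ⟨Or.inl (Finset.mem_image_of_mem _ hp), Or.inr (Finset.mem_image_of_mem _ hp)⟩

end HilbertSchmidtEntries

/-- A perturbation of a unit of a complete normed ring by less than the inverse norm of its
inverse. -/
theorem isUnit_and_norm_inverse_le {R : Type*} [NormedRing R] [CompleteSpace R] {a a' : R}
    (ha : IsUnit a) {δ : ℝ} (hδ0 : 0 ≤ δ) (hδ1 : δ < 1) (h : ‖a' - a‖ ≤ δ / ‖Ring.inverse a‖) :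
    IsUnit a' ∧ ‖Ring.inverse a'‖ ≤ ‖Ring.inverse a‖ / (1 - δ) := by
  set r := Ring.inverse a with hr
  have har : a * r = 1 := Ring.mul_inverse_cancel a ha
  have hra : r * a = 1 := Ring.inverse_mul_cancel a ha
  have hle : ‖r * (a' - a)‖ ≤ δ := by
    refine (norm_mul_le _ _).trans ((mul_le_mul_of_nonneg_left h (norm_nonneg r)).trans ?_)
    rcases eq_or_ne ‖r‖ 0 with h0 | h0
    · simpa [h0] using hδ0
    · exact (mul_div_cancel₀ δ h0).le
  have hunit : IsUnit a' := by
    have h1 : IsUnit (1 - -(r * (a' - a))) :=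
      (Units.oneSub (-(r * (a' - a))) (by rw [norm_neg]; exact hle.trans_lt hδ1)).isUnit
    have h2 : a' = a * (1 - -(r * (a' - a))) := by
      rw [sub_neg_eq_add, mul_add, ← mul_assoc, har]; simp
    rw [h2]
    exact ha.mul h1
  refine ⟨hunit, ?_⟩
  set s := Ring.inverse a' with hs
  have has : a' * s = 1 := Ring.mul_inverse_cancel a' hunit
  -- The resolvent identity; it bounds `‖s‖` by `‖r‖ + δ ‖s‖`, which is solved for `‖s‖` as `δ < 1`.
  have h3 : s = r - r * (a' - a) * s := by
    rw [mul_sub, hra, sub_mul, mul_assoc, has]; simp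
  have h4 : ‖s‖ ≤ ‖r‖ + δ * ‖s‖ :=
    calc ‖s‖ = ‖r - r * (a' - a) * s‖ := by rw [← h3]
      _ ≤ ‖r‖ + ‖r * (a' - a) * s‖ := norm_sub_le _ _
      _ ≤ ‖r‖ + δ * ‖s‖ := by
        gcongr
        exact (norm_mul_le _ _).trans (mul_le_mul_of_nonneg_right hle (norm_nonneg _))
  rw [le_div_iff₀ (by linarith)]
  linarith

/-! ### Matrix entries of `J* J` and of its sample version. -/

section Entries

variable {E : Type*} {H : Type*} [NormedAddCommGroup H] [InnerProductSpace ℝ H]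
  [CompleteSpace H] [RKHS ℝ H E ℝ]

/-- Bessel's inequality for the kernel function at `x`, whose inner product with `b i` is `b i x`.
-/
theorem sum_basis_apply_sq_le {ι : Type*} {b : ι → H} (hb : Orthonormal ℝ b) (F : Finset ι)
    (x : E) : ∑ i ∈ F, b i x ^ 2 ≤ kappa H x ^ 2 := by
  have h := hb.sum_inner_products_le (s := F) (RKHS.kerFun H x (1 : ℝ))
  rw [← kappa_eq] at h
  simpa using h

variable [MeasurableSpace E]

theorem inner_JstarJ (μ : Measure E) (hk : Measurable fun p : E × E => kernel H p.1 p.2)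
    (hκ : MemLp (kappa H) 2 μ) (f g : H) : ⟪JstarJ μ hk hκ f, g⟫_ℝ = ∫ x, f x * g x ∂μ := by
  rw [JstarJ, ContinuousLinearMap.comp_apply, ContinuousLinearMap.adjoint_inner_left, L2.inner_def]
  refine integral_congr_ae ?_
  filter_upwards [embedding_coe μ hk hκ f, embedding_coe μ hk hκ g] with x hf hg
  rw [hf, hg]
  simp [mul_comm]

theorem inner_sampleJstarJ (hk : Measurable fun p : E × E => kernel H p.1 p.2) {n : ℕ}
    (x : Fin n → E) (f g : H) :
    ⟪sampleJstarJ hk x f, g⟫_ℝ = (n : ℝ)⁻¹ * ∑ k, f (x k) * g (x k) := by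
  have hm : StronglyMeasurable fun y => f y * g y :=
    ((measurable_coe hk f).mul (measurable_coe hk g)).stronglyMeasurable
  rw [sampleJstarJ, inner_JstarJ, empiricalMeasure, integral_smul_measure,
    integral_finsetSum_measure fun i _ => integrable_dirac' hm enorm_lt_top]
  simp [integral_dirac' _ _ hm]

end Entries

/-! ### Concentration of the sample operator. -/

section Concentration

variable {E : Type*} {H : Type*} [NormedAddCommGroup H] [InnerProductSpace ℝ H]
  [RKHS ℝ H E ℝ]

/-- The matrix `(bᵢ(x) bⱼ(x))ᵢⱼ` of the rank one operator `h ↦ h(x) k(x, ·)`, as a vector with the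
Frobenius norm. -/
noncomputable def entryVector {ι : Type*} (b : ι → H) (F : Finset ι) (x : E) :
    EuclideanSpace ℝ (F × F) :=
  WithLp.toLp 2 fun p => b p.1 x * b p.2 x

/-- That the value is a square gives the nonnegativity behind the constant `√2`, besides the norm
bound. -/
theorem inner_entryVector {ι : Type*} (b : ι → H) (F : Finset ι) (x y : E) :
    ⟪entryVector b F x, entryVector b F y⟫_ℝ = (∑ i ∈ F, b i x * b i y) ^ 2 := by
  rw [← Finset.sum_coe_sort F, sq, Finset.sum_mul_sum, PiLp.inner_apply, Fintype.sum_prod_type]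
  simp only [entryVector, RCLike.inner_apply, conj_trivial]
  exact Finset.sum_congr rfl fun i _ => Finset.sum_congr rfl fun j _ => by ring

variable [CompleteSpace H]

theorem norm_entryVector_le {ι : Type*} {b : ι → H} (hb : Orthonormal ℝ b) (F : Finset ι) (x : E) :
    ‖entryVector b F x‖ ≤ kappa H x ^ 2 := by
  rw [← abs_of_nonneg (sq_nonneg (kappa H x)), ← abs_of_nonneg (norm_nonneg (entryVector b F x)),
    ← sq_le_sq, ← real_inner_self_eq_norm_sq, inner_entryVector]
  simp_rw [← sq]
  exact pow_le_pow_left₀ (Finset.sum_nonneg fun _ _ => sq_nonneg _) (sum_basis_apply_sq_le hb F x) 2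

variable [MeasurableSpace E]

theorem measurable_entryVector (hk : Measurable fun p : E × E => kernel H p.1 p.2) {ι : Type*}
    (b : ι → H) (F : Finset ι) : Measurable (entryVector b F : E → EuclideanSpace ℝ (F × F)) :=
  (WithLp.measurable_toLp 2 _).comp
    (measurable_pi_lambda _ fun p => (measurable_coe hk (b p.1)).mul (measurable_coe hk (b p.2)))

theorem measurableSet_hsNorm_le [TopologicalSpace.SeparableSpace H] {μ : Measure E} {Ω : Type*} [MeasurableSpace Ω]
    (hk : Measurable fun p : E × E => kernel H p.1 p.2)
    (hκ : MemLp (kappa H) 2 μ) {n : ℕ} {X : Fin n → Ω → E} (hXm : ∀ i, Measurable (X i))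
    (c : ℝ≥0∞) :
    MeasurableSet {ω | hsNorm (sampleJstarJ hk (fun i => X i ω) - JstarJ μ hk hκ) ≤ c} := by
  obtain ⟨w, b, -⟩ := exists_hilbertBasis ℝ H
  have := countable_of_hilbertBasis b
  simp_rw [hsNorm_le_iff_tsum_inner b]
  refine measurableSet_le (Measurable.tsum fun p => Measurable.pow_const ?_ 2)
    measurable_const
  simp_rw [_root_.sub_apply, inner_sub_left, inner_sampleJstarJ]
  exact (((Finset.measurable_fun_sum _ fun k _ =>
    ((measurable_coe hk _).comp (hXm k)).mul ((measurable_coe hk _).comp (hXm k))).const_mul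
      _).sub_const _).enorm

/-- The degenerate case, where Hoeffding has no positive bound to work with: every `h` vanishes
where `κ` does, so both operators are zero. -/
theorem ae_sampleJstarJ_eq {μ : Measure E} {Ω : Type*} [MeasurableSpace Ω] {P : Measure Ω}
    (hk : Measurable fun p : E × E => kernel H p.1 p.2)
    (hκ : MemLp (kappa H) 2 μ) (h0 : ∀ᵐ x ∂μ, kappa H x ≤ 0)
    {n : ℕ} {X : Fin n → Ω → E} (hXm : ∀ i, Measurable (X i))
    (hXlaw : ∀ i, P.map (X i) = μ) :
    ∀ᵐ ω ∂P, sampleJstarJ hk (fun i => X i ω) = JstarJ μ hk hκ := by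
  have hzero : ∀ x, kappa H x ≤ 0 → ∀ h : H, h x = 0 := fun x hx h => by
    refine norm_le_zero_iff.1 ((norm_apply_le h x).trans ?_)
    exact mul_nonpos_of_nonpos_of_nonneg hx (norm_nonneg _)
  have hX : ∀ᵐ ω ∂P, ∀ k, kappa H (X k ω) ≤ 0 :=
    ae_all_iff.2 fun k => ae_of_ae_map (hXm k).aemeasurable (by rwa [hXlaw k])
  filter_upwards [hX] with ω hω
  refine ContinuousLinearMap.ext fun f => ext_inner_right ℝ fun g => ?_
  rw [inner_sampleJstarJ, inner_JstarJ, integral_eq_zero_of_ae]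
  · simp [hzero _ (hω _)]
  · filter_upwards [h0] with x hx
    simp [hzero x hx]

variable {μ : Measure E} [IsProbabilityMeasure μ] {M : ℝ}

theorem integrable_entryVector (hk : Measurable fun p : E × E => kernel H p.1 p.2)
    (hM : ∀ᵐ x ∂μ, kappa H x ≤ M) {ι : Type*} {b : ι → H} (hb : Orthonormal ℝ b) (F : Finset ι) :
    Integrable (entryVector b F : E → EuclideanSpace ℝ (F × F)) μ := by
  refine Integrable.of_bound (measurable_entryVector hk b F).aestronglyMeasurable (M ^ 2) ?_
  filter_upwards [hM] with x hx
  exact (norm_entryVector_le hb F x).trans (pow_le_pow_left₀ (Real.sqrt_nonneg _) hx 2)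

/-- With `m` the mean, `‖v - m‖² = ‖v‖² - 2 ⟪v, m⟫ + ‖m‖² ≤ 2 M⁴` because `⟪v, m⟫ ≥ 0`. The triangle
inequality would only give `2 M²`, hence `8` instead of `4` in the exponent. -/
theorem norm_entryVector_sub_integral_le (hk : Measurable fun p : E × E => kernel H p.1 p.2)
    (hM : ∀ᵐ x ∂μ, kappa H x ≤ M) {ι : Type*} {b : ι → H} (hb : Orthonormal ℝ b) (F : Finset ι) :
    ∀ᵐ x ∂μ, ‖entryVector b F x - ∫ y, entryVector b F y ∂μ‖ ≤ √2 * M ^ 2 := by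
  have hbound : ∀ᵐ x ∂μ, ‖entryVector b F x‖ ≤ M ^ 2 := by
    filter_upwards [hM] with x hx
    exact (norm_entryVector_le hb F x).trans (pow_le_pow_left₀ (Real.sqrt_nonneg _) hx 2)
  have hint : ‖∫ y, entryVector b F y ∂μ‖ ≤ M ^ 2 := by
    simpa using norm_integral_le_of_norm_le_const hbound
  filter_upwards [hbound] with x hx
  have hinner : 0 ≤ ⟪entryVector b F x, ∫ y, entryVector b F y ∂μ⟫_ℝ := by
    rw [← integral_inner (integrable_entryVector hk hM hb F)]
    refine integral_nonneg fun y => ?_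
    rw [Pi.zero_apply, inner_entryVector]
    exact sq_nonneg _
  refine abs_le_of_sq_le_sq' ?_ (by positivity) |>.2
  rw [norm_sub_sq_real, mul_pow, Real.sq_sqrt (by norm_num)]
  have h1 := pow_le_pow_left₀ (norm_nonneg _) hx 2
  have h2 := pow_le_pow_left₀ (norm_nonneg _) hint 2
  linarith

theorem integral_entryVector_apply (hk : Measurable fun p : E × E => kernel H p.1 p.2)
    (hκ : MemLp (kappa H) 2 μ) (hM : ∀ᵐ x ∂μ, kappa H x ≤ M) {ι : Type*} {b : ι → H}
    (hb : Orthonormal ℝ b) (F : Finset ι) (p : F × F) :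
    (∫ x, entryVector b F x ∂μ) p = ⟪JstarJ μ hk hκ (b p.1), b p.2⟫_ℝ := by
  rw [inner_JstarJ]
  exact ((EuclideanSpace.proj p : EuclideanSpace ℝ (F × F) →L[ℝ] ℝ).integral_comp_comm
    (integrable_entryVector hk hM hb F)).symm

/-- The squared Frobenius norm of the compression of `J_x* J_x - J* J` to finitely many elements of
an orthonormal family. -/
theorem norm_sum_entryVector_sq (hk : Measurable fun p : E × E => kernel H p.1 p.2)
    (hκ : MemLp (kappa H) 2 μ) (hM : ∀ᵐ x ∂μ, kappa H x ≤ M) {ι : Type*} {b : ι → H}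
    (hb : Orthonormal ℝ b) (F : Finset ι) {n : ℕ} (hn : 0 < n) (x : Fin n → E) :
    ‖∑ k, (entryVector b F (x k) - ∫ y, entryVector b F y ∂μ)‖ ^ 2 =
      (n : ℝ) ^ 2 *
        ∑ p ∈ F ×ˢ F, ⟪(sampleJstarJ hk x - JstarJ μ hk hκ) (b p.1), b p.2⟫_ℝ ^ 2 := by
  have hn' : (n : ℝ) ≠ 0 := by positivity
  have hentry : ∀ p : F × F, (∑ k, (entryVector b F (x k) - ∫ y, entryVector b F y ∂μ)) p =
      n * ⟪(sampleJstarJ hk x - JstarJ μ hk hκ) (b p.1), b p.2⟫_ℝ := by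
    intro p
    rw [_root_.sub_apply, inner_sub_left, inner_sampleJstarJ,
      ← integral_entryVector_apply hk hκ hM hb F p, mul_sub, mul_inv_cancel_left₀ hn']
    simp [entryVector]
  rw [EuclideanSpace.real_norm_sq_eq]
  simp_rw [hentry, mul_pow]
  rw [← Finset.mul_sum, Fintype.sum_prod_type, Finset.sum_product, ← Finset.sum_coe_sort F]
  congr 1
  refine Finset.sum_congr rfl fun i _ => ?_
  rw [← Finset.sum_coe_sort F]

variable {Ω : Type*} [MeasurableSpace Ω] {P : Measure Ω} [IsProbabilityMeasure P]

theorem measureReal_compression_gt_le (hk : Measurable fun p : E × E => kernel H p.1 p.2)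
    (hκ : MemLp (kappa H) 2 μ) (hM0 : 0 < M) (hM : ∀ᵐ x ∂μ, kappa H x ≤ M) {ι : Type*} {b : ι → H}
    (hb : Orthonormal ℝ b) (F : Finset ι) {n : ℕ} (hn : 0 < n) {X : Fin n → Ω → E}
    (hXm : ∀ i, Measurable (X i)) (hXind : iIndepFun X P) (hXlaw : ∀ i, P.map (X i) = μ)
    {t : ℝ} (ht : 0 ≤ t) :
    P.real {ω | t ^ 2 < ∑ p ∈ F ×ˢ F,
        ⟪(sampleJstarJ hk (fun i => X i ω) - JstarJ μ hk hκ) (b p.1), b p.2⟫_ℝ ^ 2} ≤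
      2 * Real.exp (-(t ^ 2 * n / (4 * M ^ 4))) := by
  have : Nonempty (Fin n) := ⟨⟨0, hn⟩⟩
  have hn' : (0 : ℝ) < n := by positivity
  let f : E → EuclideanSpace ℝ (F × F) := fun x => entryVector b F x - ∫ y, entryVector b F y ∂μ
  have hf : Measurable f := (measurable_entryVector hk b F).sub_const _
  have hfb : ∀ᵐ x ∂μ, ‖f x‖ ≤ √2 * M ^ 2 := norm_entryVector_sub_integral_le hk hM hb F
  have hmean : ∫ x, f x ∂μ = 0 := by
    rw [integral_sub (integrable_entryVector hk hM hb F) (integrable_const _)]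
    simp
  have h := measureReal_norm_sum_gt_le (P := P) (Y := fun k ω => f (X k ω)) (b := √2 * M ^ 2)
    (fun k => hf.comp (hXm k)) (hXind.comp (fun _ => f) fun _ => hf) (by positivity)
    (fun k => ae_of_ae_map (hXm k).aemeasurable (by rwa [hXlaw k]))
    (fun k => by rw [← integral_map (hXm k).aemeasurable hf.aestronglyMeasurable, hXlaw k, hmean])
    (r := n * t) (by positivity)
  have hset : {ω | t ^ 2 < ∑ p ∈ F ×ˢ F,
      ⟪(sampleJstarJ hk (fun i => X i ω) - JstarJ μ hk hκ) (b p.1), b p.2⟫_ℝ ^ 2} =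
      {ω | n * t < ‖∑ k, f (X k ω)‖} := by
    ext ω
    rw [Set.mem_ofPred_eq, Set.mem_ofPred_eq, ← sq_lt_sq₀ (by positivity) (norm_nonneg _),
      norm_sum_entryVector_sq hk hκ hM hb F hn (fun k => X k ω), mul_pow]
    exact (mul_lt_mul_iff_right₀ (by positivity)).symm
  rw [hset]
  refine h.trans_eq ?_
  congr 3
  rw [Fintype.card_fin, mul_pow, mul_pow, Real.sq_sqrt (by norm_num)]
  field_simp
  ring

variable [TopologicalSpace.SeparableSpace H]

theorem measure_hsNorm_gt_le (hk : Measurable fun p : E × E => kernel H p.1 p.2)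
    (hκ : MemLp (kappa H) 2 μ) (hM0 : 0 < M) (hM : ∀ᵐ x ∂μ, kappa H x ≤ M)
    {n : ℕ} (hn : 0 < n) {X : Fin n → Ω → E}
    (hXm : ∀ i, Measurable (X i)) (hXind : iIndepFun X P) (hXlaw : ∀ i, P.map (X i) = μ)
    {t : ℝ} (ht : 0 ≤ t) :
    P {ω | hsNorm (sampleJstarJ hk (fun i => X i ω) - JstarJ μ hk hκ) ≤ ENNReal.ofReal t}ᶜ ≤
      2 * ENNReal.ofReal (Real.exp (-(t ^ 2 * n / (4 * M ^ 4)))) := by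
  obtain ⟨w, b, -⟩ := exists_hilbertBasis ℝ H
  have := countable_of_hilbertBasis b
  have hset : {ω | hsNorm (sampleJstarJ hk (fun i => X i ω) - JstarJ μ hk hκ) ≤
      ENNReal.ofReal t}ᶜ = ⋃ F : Finset w, {ω | t ^ 2 < ∑ p ∈ F ×ˢ F,
        ⟪(sampleJstarJ hk (fun i => X i ω) - JstarJ μ hk hκ) (b p.1), b p.2⟫_ℝ ^ 2} := by
    ext ω
    simp [hsNorm_le_iff_forall_sum b _ ht]
  -- For a countable directed union the measure is a supremum, so the uniform bound survives.
  rw [hset, Directed.measure_iUnion]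
  · refine iSup_le fun F => ?_
    rw [← ofReal_measureReal, ← ENNReal.ofReal_ofNat 2, ← ENNReal.ofReal_mul (by norm_num)]
    exact ENNReal.ofReal_le_ofReal
      (measureReal_compression_gt_le hk hκ hM0 hM b.orthonormal F hn hXm hXind hXlaw ht)
  · refine directed_of_isDirected_le fun F G hFG ω hω => ?_
    refine lt_of_lt_of_le (Set.mem_ofPred_eq ▸ hω) ?_
    exact Finset.sum_le_sum_of_subset_of_nonneg (Finset.product_subset_product hFG hFG)
      fun _ _ _ => sq_nonneg _

end Concentration

end KernelSampling

/-! ### The sampling theorem, with its degenerate cases. -/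

theorem mainTheorem7
    {E : Type*} [MeasurableSpace E] (μ : Measure E) [IsProbabilityMeasure μ]
    {H : Type*} [NormedAddCommGroup H] [InnerProductSpace ℝ H] [CompleteSpace H]
    [TopologicalSpace.SeparableSpace H] [RKHS ℝ H E ℝ]
    (hk : Measurable fun p : E × E => KernelSampling.kernel H p.1 p.2)
    (hκ : MemLp (KernelSampling.kappa H) 2 μ)
    (lam : ℝ) (hlam : 0 ≤ lam)
    (hinv : IsUnit (KernelSampling.JstarJ μ hk hκ + lam • (1 : H →L[ℝ] H)))
    (δ : ℝ) (hδ0 : 0 ≤ δ) (hδ1 : δ < 1)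
    {Ω : Type*} [MeasurableSpace Ω] (P : Measure Ω) [IsProbabilityMeasure P]
    (n : ℕ) (hn : 0 < n) (X : Fin n → Ω → E)
    (hXm : ∀ i, Measurable (X i)) (hXind : iIndepFun X P) (hXlaw : ∀ i, P.map (X i) = μ) :
    (∀ ω ∈ KernelSampling.samplingEvent μ hk hκ lam δ X,
      IsUnit (KernelSampling.sampleJstarJ hk (fun i => X i ω) + lam • (1 : H →L[ℝ] H)) ∧
      ‖Ring.inverse
          (KernelSampling.sampleJstarJ hk (fun i => X i ω) + lam • (1 : H →L[ℝ] H))‖ ≤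
        ‖Ring.inverse (KernelSampling.JstarJ μ hk hκ + lam • (1 : H →L[ℝ] H))‖ / (1 - δ)) ∧
    MeasurableSet (KernelSampling.samplingEvent μ hk hκ lam δ X) ∧
    1 - 2 * EReal.exp (-((ENNReal.ofReal δ ^ 2 * (n : ℝ≥0∞) /
          (4 * eLpNorm (KernelSampling.kappa H) ∞ μ ^ 4 *
            ‖Ring.inverse (KernelSampling.JstarJ μ hk hκ + lam • (1 : H →L[ℝ] H))‖ₑ ^ 2) :
          ℝ≥0∞) : EReal)) ≤
      P (KernelSampling.samplingEvent μ hk hκ lam δ X) := by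
  open KernelSampling in
  set R := Ring.inverse (JstarJ μ hk hκ + lam • (1 : H →L[ℝ] H))
  have hr0 : 0 ≤ δ / ‖R‖ := div_nonneg hδ0 (norm_nonneg _)
  have hmeas : MeasurableSet (samplingEvent μ hk hκ lam δ X) := measurableSet_hsNorm_le hk hκ hXm _
  refine ⟨fun ω hω => ?_, hmeas, ?_⟩
  · refine isUnit_and_norm_inverse_le hinv hδ0 hδ1 ?_
    rw [add_sub_add_right_eq_sub, ← ENNReal.ofReal_le_ofReal_iff hr0, ofReal_norm]
    exact (norm_le_hsNorm _).trans hω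
  have hae : (∀ᵐ ω ∂P, sampleJstarJ hk (fun i => X i ω) = JstarJ μ hk hκ) →
      P (samplingEvent μ hk hκ lam δ X) = 1 := fun h => by
    rw [← prob_compl_eq_zero_iff hmeas, ← mem_ae_iff]
    filter_upwards [h] with ω hω
    have : hsNorm (sampleJstarJ hk (fun i => X i ω) - JstarJ μ hk hκ) = 0 := by
      simp [hω, hsNorm]
    exact this.trans_le zero_le
  -- Only for trivial `H` can the inverse have norm `0`; the event then has full measure.
  rcases subsingleton_or_nontrivial H with hH | hH
  · rw [hae (Filter.Eventually.of_forall fun ω => Subsingleton.elim _ _)]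
    exact tsub_le_self
  have hRpos : 0 < ‖R‖ := norm_pos_iff.2 hinv.ringInverse.ne_zero
  have hRe : ‖R‖ₑ = ENNReal.ofReal ‖R‖ := (ofReal_norm R).symm
  have hRe0 : ‖R‖ₑ ≠ 0 := by
    rw [hRe]
    exact (ENNReal.ofReal_pos.2 hRpos).ne'
  -- For unbounded `κ` the exponential is `1`, and `1 - 2` truncates to `0` in `[0, ∞]`.
  rcases eq_or_ne (eLpNorm (kappa H) ∞ μ) ∞ with htop | htop
  · rw [htop, ENNReal.top_pow (by norm_num), ENNReal.mul_top (by norm_num),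
      ENNReal.top_mul (pow_ne_zero 2 hRe0), ENNReal.div_top]
    simp only [EReal.coe_ennreal_zero, neg_zero, EReal.exp_zero, mul_one]
    exact (tsub_eq_zero_of_le one_le_two).trans_le zero_le
  obtain ⟨M, hM0, hMe⟩ : ∃ M : ℝ, 0 ≤ M ∧ eLpNorm (kappa H) ∞ μ = ENNReal.ofReal M :=
    ⟨_, ENNReal.toReal_nonneg, (ENNReal.ofReal_toReal htop).symm⟩
  have hM : ∀ᵐ x ∂μ, kappa H x ≤ M := by
    filter_upwards [ae_le_eLpNormEssSup (f := kappa H) (μ := μ)] with x hx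
    rw [← eLpNorm_exponent_top, hMe, ← ofReal_norm, ENNReal.ofReal_le_ofReal_iff hM0] at hx
    exact (le_abs_self _).trans hx
  rcases hM0.eq_or_lt with h0 | hMpos
  · rw [hae (ae_sampleJstarJ_eq hk hκ (by rwa [← h0] at hM) hXm hXlaw)]
    exact tsub_le_self
  have hfrac : ENNReal.ofReal δ ^ 2 * (n : ℝ≥0∞) /
      (4 * eLpNorm (kappa H) ∞ μ ^ 4 * ‖R‖ₑ ^ 2) =
      ENNReal.ofReal ((δ / ‖R‖) ^ 2 * n / (4 * M ^ 4)) := by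
    have h1 : (δ / ‖R‖) ^ 2 * n / (4 * M ^ 4) = δ ^ 2 * n / (4 * M ^ 4 * ‖R‖ ^ 2) := by
      field_simp
    rw [h1, ENNReal.ofReal_div_of_pos (by positivity), ENNReal.ofReal_mul (by positivity),
      ENNReal.ofReal_mul (by positivity), ENNReal.ofReal_mul (by positivity),
      ENNReal.ofReal_pow hδ0, ENNReal.ofReal_pow hMpos.le, ENNReal.ofReal_pow hRpos.le,
      ENNReal.ofReal_natCast, ENNReal.ofReal_ofNat, hMe, hRe]
  have htail := measure_hsNorm_gt_le hk hκ hMpos hM hn hXm hXind hXlaw hr0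
  rw [hfrac, EReal.coe_ennreal_ofReal, max_eq_left (by positivity), ← EReal.coe_neg,
    EReal.exp_coe, tsub_le_iff_right, ← prob_add_prob_compl (μ := P) hmeas]
  gcongr
  exact htail
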